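/- All graphs are finite and simple. For a connected graph $G$ with at least three vertices, let $rx_3(G)$ (the $3$-rainbow index) be the minimum number of colors in an edge-coloring of $G$ (adjacent edges may share a color) such that every set $S$ of three vertices is contained in the vertex set of a subtree of $G$ whose edges have pairwise distinct colors, and let $sdiam_3(G)$ (the $3$-Steiner diameter) be the maximum, over all sets $S$ of three vertices of $G$, of the minimum number of edges of a subtree of $G$ containing $S$. For a family $\mathcal{F}$ of graphs, $G$ is $\mathcal{F}$-free if no induced subgraph of $G$ is isomorphic to a member of $\mathcal{F}$. Let $P_n$ be the path on $n$ vertices, $K_{1,r}$ the star with $r$ edges, and $K_s^h$ the graph obtained from the complete graph $K_s$ by attaching one pendant edge to each of its vertices. **Theorem 10.** Let $\mathcal{F}$ be a finite family of connected graphs, each with at least three vertices. Then there is a constant $C_{\mathcal{F}}$ such that every connected $\mathcal{F}$-free graph $G$ with at least three vertices satisfies $rx_3(G)\leq sdiam_3(G)+C_{\mathcal{F}}$ if and only if $\mathcal{F}$ contains (up to isomorphism) a subfamily $\mathcal{F}'\in\mathfrak{F}_1\cup\mathfrak{F}_2\cup\mathfrak{F}_3$, where $$\mathfrak{F}_1=\{\{P_3\}\},\qquad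 \mathfrak{F}_2=\{\{K_{1,r},P_4\} : r\geq 3\},$$ $$\mathfrak{F}_3=\{\{K_{1,r},Y,P_\ell\} : r\geq 3,\ \ell>4,\ Y \text{ an induced subgraph of } K_s^h \text{ for some } s\geq 3\}.$$ -/

import Mathlib

namespace SimpleGraph

/-- A subgraph `T` of `G` is an `S`-tree: it is a tree whose vertex set contains `S`. -/
def IsSTree {V : Type*} (G : SimpleGraph V) (S : Finset V) (T : G.Subgraph) : Prop :=
  T.coe.IsTree ∧ (S : Set V) ⊆ T.verts

/-- A subgraph `T` of an edge-coloured graph is rainbow: no two of its edges have the same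
colour. -/
def IsRainbow {V K : Type*} {G : SimpleGraph V} (c : G.edgeSet → K) (T : G.Subgraph) : Prop :=
  ∀ e f : G.edgeSet, (e : Sym2 V) ∈ T.edgeSet → (f : Sym2 V) ∈ T.edgeSet → c e = c f → e = f

/-- A `k`-rainbow colouring: every set `S` of `k` vertices has a rainbow `S`-tree. -/
def IsRainbowColoring {V K : Type*} {G : SimpleGraph V} (k : ℕ) (c : G.edgeSet → K) : Prop :=
  ∀ S : Finset V, S.card = k → ∃ T : G.Subgraph, G.IsSTree S T ∧ IsRainbow c T

/-- The `k`-rainbow index `rx_k(G)`: the minimum number of colours in a `k`-rainbow colouring. -/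
noncomputable def rainbowIndex {V : Type*} (k : ℕ) (G : SimpleGraph V) : ℕ :=
  sInf {t : ℕ | ∃ c : G.edgeSet → Fin t, IsRainbowColoring k c}

/-- The Steiner distance `d(S)`: the minimum number of edges of an `S`-tree. -/
noncomputable def steinerDist {V : Type*} (G : SimpleGraph V) (S : Finset V) : ℕ :=
  sInf {m : ℕ | ∃ T : G.Subgraph, G.IsSTree S T ∧ T.edgeSet.ncard = m}

/-- The `k`-Steiner diameter `sdiam_k(G)`: the maximum Steiner distance of a set of `k`
vertices. -/
noncomputable def steinerDiam {V : Type*} (k : ℕ) (G : SimpleGraph V) : ℕ :=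
  sSup {d : ℕ | ∃ S : Finset V, S.card = k ∧ G.steinerDist S = d}

/-- The star `K_{1,r}`. -/
abbrev starK (r : ℕ) : SimpleGraph (Fin 1 ⊕ Fin r) := completeBipartiteGraph (Fin 1) (Fin r)

/-- The graph `K_s^h`, obtained from the complete graph on `s` vertices (the left summand)
by attaching one pendant edge to each of its vertices (pendant vertices: the right summand). -/
def hairyComplete (s : ℕ) : SimpleGraph (Fin s ⊕ Fin s) where
  Adj
    | .inl i, .inl j => i ≠ j
    | .inl i, .inr j => i = j
    | .inr i, .inl j => i = j
    | .inr _, .inr _ => False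
  symm := ⟨by
    rintro (i | i) (j | j) h
    · exact Ne.symm h
    · exact Eq.symm h
    · exact Eq.symm h
    · exact h⟩
  loopless := ⟨by
    rintro (i | i) h
    · exact h rfl
    · exact h⟩

section Families

variable {ι : Type*} {V : ι → Type*}

/-- `G` is free of the family `F`: no member of `F` is isomorphic to an induced subgraph
of `G`. -/
def IsFamilyFree {W : Type*} (F : ∀ i, SimpleGraph (V i)) (G : SimpleGraph W) : Prop :=
  ∀ i, ¬ (F i).IsIndContained G

/-- The family `F` contains (up to isomorphism) the graph `H`. -/
def FamilyContains {W : Type*} (F : ∀ i, SimpleGraph (V i)) (H : SimpleGraph W) : Prop :=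
  ∃ i, Nonempty (F i ≃g H)

/-- `F` contains the subfamily `{P₃}`. -/
def ContainsFirst (F : ∀ i, SimpleGraph (V i)) : Prop :=
  FamilyContains F (pathGraph 3)

/-- `F` contains a subfamily `{K_{1,r}, P₄}` with `r ≥ 3`. -/
def ContainsSecond (F : ∀ i, SimpleGraph (V i)) : Prop :=
  ∃ r : ℕ, 3 ≤ r ∧ FamilyContains F (starK r) ∧ FamilyContains F (pathGraph 4)

/-- `F` contains a subfamily `{K_{1,r}, Y, P_ℓ}` with `r ≥ 3`, `ℓ > 4` and `Y` an induced
subgraph of `K_s^h` for some `s ≥ 3`. -/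
def ContainsThird (F : ∀ i, SimpleGraph (V i)) : Prop :=
  ∃ r s l : ℕ, 3 ≤ r ∧ 3 ≤ s ∧ 4 < l ∧ FamilyContains F (starK r) ∧
    (∃ i, (F i).IsIndContained (hairyComplete s)) ∧ FamilyContains F (pathGraph l)

end Families

end SimpleGraph

/-! Necessity: given the constant C, three kinds of connected graphs violate the bound. In a large
star or a large K_s^h all pendant edges need distinct colours (`card_le_rainbowIndex_of_pendant`),
while the Steiner diameter stays at most 4 or 6. In a long cycle C_n, rx_3 is at least n - 2
(`le_rainbowIndex_of_iso_cycleGraph`) but sdiam_3 is at most 2n/3. So each of them contains a member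
of F as an induced subgraph. Such a member is a star in the first case and, since F is finite and
the cycle can be taken longer than every member, a path in the last.

Sufficiency: each listed subfamily excludes some K_{1,r}, K_s^h and P_l, and then rx_3 itself is
bounded (`exists_bound_rainbowIndex`). There are at most l distance levels from a vertex, and
Ramsey's theorem with private neighbours bounds independent sets level by level
(`exists_bound_indepSet_level`). Hence some 3-fold dominating set has bounded size, and geodesics
join it into a bounded connected subgraph H. Colour every edge by its set of ends in H: three
vertices outside H can be attached to H at three different places, and H with these pendant edges is
rainbow. -/

namespace SimpleGraph

variable {W : Type*}

/-! ### Basic bounds for the rainbow index and the Steiner diameter. -/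

/-- Every finite connected subgraph has a spanning tree. -/
theorem Subgraph.Connected.exists_spanning_tree [Finite W] {G : SimpleGraph W} {H : G.Subgraph}
    (hH : H.Connected) : ∃ T : G.Subgraph, T ≤ H ∧ T.verts = H.verts ∧ T.coe.IsTree := by
  obtain ⟨T', hle, hT'⟩ := hH.coe.exists_isTree_le
  let T : G.Subgraph :=
    { verts := H.verts
      Adj := fun a b => ∃ (ha : a ∈ H.verts) (hb : b ∈ H.verts), T'.Adj ⟨a, ha⟩ ⟨b, hb⟩
      adj_sub := fun ⟨_, _, h⟩ => H.adj_sub (hle h)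
      edge_vert := fun ⟨ha, _, _⟩ => ha
      symm := ⟨fun _ _ ⟨ha, hb, h⟩ => ⟨hb, ha, h.symm⟩⟩ }
  have hT : T.coe = T' := by
    ext a b
    exact ⟨fun ⟨_, _, h⟩ => h, fun h => ⟨a.2, b.2, h⟩⟩
  exact ⟨T, ⟨le_rfl, fun _ _ ⟨_, _, h⟩ => hle h⟩, rfl, hT ▸ hT'⟩

theorem IsRainbow.mono {K : Type*} {G : SimpleGraph W} {c : G.edgeSet → K} {T H : G.Subgraph}
    (hH : IsRainbow c H) (hle : T ≤ H) : IsRainbow c T := fun e f he hf =>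
  hH e f (Subgraph.edgeSet_mono hle he) (Subgraph.edgeSet_mono hle hf)

/-- Deleting edges preserves rainbowness, so a spanning tree of the connected subgraph serves; later
constructions need not produce trees. -/
theorem isRainbowColoring_of_connected [Finite W] {K : Type*} {G : SimpleGraph W} {k : ℕ}
    {c : G.edgeSet → K}
    (h : ∀ S : Finset W, S.card = k →
      ∃ H : G.Subgraph, H.Connected ∧ (S : Set W) ⊆ H.verts ∧ IsRainbow c H) :
    IsRainbowColoring k c := by
  intro S hS
  obtain ⟨H, hH, hSH, hc⟩ := h S hS
  obtain ⟨T, hTH, hv, hT⟩ := hH.exists_spanning_tree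
  exact ⟨T, ⟨hT, hv ▸ hSH⟩, hc.mono hTH⟩

theorem IsRainbowColoring.comp_injective {K L : Type*} {G : SimpleGraph W} {k : ℕ}
    {c : G.edgeSet → K} (hc : IsRainbowColoring k c) {f : K → L} (hf : Function.Injective f) :
    IsRainbowColoring k (f ∘ c) := by
  intro S hS
  obtain ⟨T, hT, hr⟩ := hc S hS
  exact ⟨T, hT, fun e e' he he' h => hr e e' he he' (hf h)⟩

theorem rainbowIndex_le_card {K : Type*} [Finite K] {G : SimpleGraph W} {k : ℕ}
    {c : G.edgeSet → K} (hc : IsRainbowColoring k c) : rainbowIndex k G ≤ Nat.card K :=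
  Nat.sInf_le ⟨_, hc.comp_injective (Finite.equivFin K).injective⟩

/-- A finite connected graph has a rainbow colouring with `rainbowIndex` colours. -/
theorem Connected.exists_rainbowIndex_coloring [Finite W] {G : SimpleGraph W} (hG : G.Connected)
    (k : ℕ) : ∃ c : G.edgeSet → Fin (rainbowIndex k G), IsRainbowColoring k c := by
  -- The infimum is attained because the set is nonempty: give all edges different colours.
  refine Nat.sInf_mem (s := {t : ℕ | ∃ c : G.edgeSet → Fin t, IsRainbowColoring k c})
    ⟨Nat.card G.edgeSet, Finite.equivFin G.edgeSet, ?_⟩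
  refine isRainbowColoring_of_connected fun S _ => ⟨⊤, ?_, fun _ _ => trivial, ?_⟩
  · exact ⟨Subgraph.topIso.connected_iff.mpr hG⟩
  · exact fun e f _ _ h => (Finite.equivFin G.edgeSet).injective h

theorem Subgraph.Connected.steinerDist_le [Finite W] {G : SimpleGraph W} {H : G.Subgraph}
    (hH : H.Connected) {S : Finset W} (hS : (S : Set W) ⊆ H.verts) :
    G.steinerDist S ≤ H.edgeSet.ncard := by
  obtain ⟨T, hTH, hv, hT⟩ := hH.exists_spanning_tree
  have h : G.steinerDist S ≤ T.edgeSet.ncard := Nat.sInf_le ⟨T, ⟨hT, hv ▸ hS⟩, rfl⟩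
  refine h.trans ?_
  exact Set.ncard_le_ncard (Subgraph.edgeSet_mono hTH) (Set.toFinite _)

theorem Walk.ncard_edgeSet_toSubgraph_le {G : SimpleGraph W} {u v : W} (p : G.Walk u v) :
    p.toSubgraph.edgeSet.ncard ≤ p.length := by
  classical
  rw [edgeSet_toSubgraph, ← p.length_edges]
  have : p.edgeSet = (p.edges.toFinset : Set (Sym2 W)) := by
    ext e
    simp [Walk.edgeSet]
  rw [this, Set.ncard_coe_finset]
  exact List.toFinset_card_le _

theorem steinerDist_le_of_walks [Finite W] {G : SimpleGraph W} {x y z : W} {S : Finset W}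
    (p : G.Walk x y) (q : G.Walk y z) (hS : ∀ w ∈ S, w = x ∨ w = y ∨ w = z) :
    G.steinerDist S ≤ p.length + q.length := by
  have hc : (p.toSubgraph ⊔ q.toSubgraph).Connected :=
    Subgraph.connected_sup p.toSubgraph_connected.preconnected
      q.toSubgraph_connected.preconnected
      ⟨y, p.end_mem_verts_toSubgraph, q.start_mem_verts_toSubgraph⟩
  refine (hc.steinerDist_le ?_).trans ?_
  · intro w hw
    rcases hS w hw with rfl | rfl | rfl
    · exact Or.inl p.start_mem_verts_toSubgraph
    · exact Or.inl p.end_mem_verts_toSubgraph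
    · exact Or.inr q.end_mem_verts_toSubgraph
  · rw [Subgraph.edgeSet_sup]
    exact (Set.ncard_union_le _ _).trans
      (add_le_add p.ncard_edgeSet_toSubgraph_le q.ncard_edgeSet_toSubgraph_le)

theorem steinerDiam_le {G : SimpleGraph W} {k m : ℕ}
    (h : ∀ S : Finset W, S.card = k → G.steinerDist S ≤ m) : steinerDiam k G ≤ m :=
  csSup_le' (by rintro _ ⟨S, hS, rfl⟩; exact h S hS)

theorem steinerDiam_three_le_of_walks [Finite W] {G : SimpleGraph W} {m : ℕ}
    (h : ∀ x y, ∃ p : G.Walk x y, p.length ≤ m) : steinerDiam 3 G ≤ 2 * m := by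
  classical
  refine steinerDiam_le fun S hS => ?_
  obtain ⟨x, y, z, -, -, -, rfl⟩ := Finset.card_eq_three.mp hS
  obtain ⟨p, hp⟩ := h x y
  obtain ⟨q, hq⟩ := h y z
  have := steinerDist_le_of_walks p q (S := {x, y, z}) (by simp)
  omega

/-- A property preserved along edges of a connected graph holds everywhere once it holds
somewhere. -/
theorem Connected.forall_of_adj_closed {G : SimpleGraph W} (hG : G.Connected) {P : W → Prop}
    (hP : ∀ a b, G.Adj a b → P a → P b) {a : W} (ha : P a) (b : W) : P b := by
  obtain ⟨p⟩ := hG.preconnected a b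
  induction p with
  | nil => exact ha
  | cons h _ ih => exact ih (hP _ _ h ha)

theorem Subgraph.Connected.forall_of_adj_closed {G : SimpleGraph W} {H : G.Subgraph}
    (hH : H.Connected) {P : W → Prop} (hP : ∀ a b, H.Adj a b → P a → P b) {a b : W}
    (ha : a ∈ H.verts) (hPa : P a) (hb : b ∈ H.verts) : P b :=
  SimpleGraph.Connected.forall_of_adj_closed (P := fun w : H.verts => P w) hH.coe
    (fun a b h => hP a b h) (a := ⟨a, ha⟩) hPa ⟨b, hb⟩

/-- Pendant edges of a graph receive distinct colours in every `3`-rainbow colouring. -/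
theorem card_le_rainbowIndex_of_pendant [Finite W] {G : SimpleGraph W} (hG : G.Connected)
    (hW : 3 ≤ Nat.card W) {n : ℕ} {u w : Fin n → W} (hu : Function.Injective u)
    (huw : ∀ i j, u i ≠ w j) (hadj : ∀ i x, G.Adj (u i) x ↔ x = w i) :
    n ≤ rainbowIndex 3 G := by
  classical
  have := Fintype.ofFinite W
  obtain ⟨c, hc⟩ := hG.exists_rainbowIndex_coloring 3
  let e : Fin n → G.edgeSet := fun i => ⟨s(u i, w i), (hadj i _).2 rfl⟩
  suffices h : Function.Injective (c ∘ e) by simpa using Fintype.card_le_of_injective _ h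
  intro i j hij
  by_contra hne
  have hne' : u i ≠ u j := hu.ne hne
  obtain ⟨S, hS, hcard⟩ := Finset.exists_superset_card_eq (s := {u i, u j}) (n := 3)
    (by rw [Finset.card_pair hne']; norm_num) (by rwa [Nat.card_eq_fintype_card] at hW)
  obtain ⟨T, ⟨hT, hST⟩, hr⟩ := hc S hcard
  have hi : u i ∈ T.verts := hST (hS (by simp))
  have hj : u j ∈ T.verts := hST (hS (by simp))
  -- Without its pendant edge, `u i` would be isolated in `T`, which also contains `u j`.
  have key : ∀ i j, i ≠ j → u i ∈ T.verts → u j ∈ T.verts → T.Adj (u i) (w i) := by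
    intro i j hne hi hj
    by_contra hn
    refine hu.ne hne (Subgraph.Connected.forall_of_adj_closed ⟨hT.connected⟩
      (P := fun x => x = u i) ?_ hi rfl hj).symm
    rintro a b hab rfl
    rw [(hadj i b).1 hab.adj_sub] at hab
    exact (hn hab).elim
  have h := hr (e i) (e j) (key i j hne hi hj) (key j i (Ne.symm hne) hj hi) hij
  have h' : s(u i, w i) = s(u j, w j) := congrArg Subtype.val h
  rcases Sym2.eq_iff.1 h' with ⟨h1, -⟩ | ⟨h1, -⟩
  · exact hne' h1
  · exact huw _ _ h1

end SimpleGraph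

/-! ### Bounded independence number from the three excluded subgraphs. -/

namespace SimpleGraph

universe u

/-- Ramsey's theorem for cliques and independent sets. -/
theorem exists_clique_or_indepSet (s t : ℕ) : ∃ N : ℕ, ∀ {W : Type u} (G : SimpleGraph W)
    (A : Finset W), N ≤ A.card →
      (∃ T ⊆ A, G.IsClique T ∧ T.card = s) ∨ (∃ T ⊆ A, G.IsIndepSet T ∧ T.card = t) := by
  classical
  induction s generalizing t with
  | zero => exact ⟨0, fun G A _ => Or.inl ⟨∅, by simp, by simp, rfl⟩⟩
  | succ s ihs =>
    induction t with
    | zero => exact ⟨0, fun G A _ => Or.inr ⟨∅, by simp, by simp [IsIndepSet], rfl⟩⟩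
    | succ t iht =>
      obtain ⟨N₁, h₁⟩ := ihs (t + 1)
      obtain ⟨N₂, h₂⟩ := iht
      refine ⟨N₁ + N₂ + 1, fun {W} G A hA => ?_⟩
      obtain ⟨v, hv⟩ : A.Nonempty := Finset.card_pos.mp (by omega)
      have hsum := Finset.card_filter_add_card_filter_not (s := A.erase v) (G.Adj v)
      rw [Finset.card_erase_of_mem hv] at hsum
      have hsub : ∀ p : W → Prop, ∀ [DecidablePred p], ∀ T ⊆ (A.erase v).filter p, T ⊆ A :=
        fun p _ T hT x hx => Finset.mem_of_mem_erase (Finset.mem_filter.1 (hT hx)).1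
      have hnot : ∀ p : W → Prop, ∀ [DecidablePred p], ∀ T ⊆ (A.erase v).filter p, v ∉ T :=
        fun p _ T hT hx => Finset.ne_of_mem_erase (Finset.mem_filter.1 (hT hx)).1 rfl
      by_cases hc : N₁ ≤ ((A.erase v).filter (G.Adj v)).card
      · rcases h₁ G _ hc with ⟨T, hT, hcl, hcard⟩ | ⟨T, hT, hind, hcard⟩
        · refine Or.inl ⟨insert v T, Finset.insert_subset hv (hsub _ T hT), ?_, ?_⟩
          · rw [Finset.coe_insert, isClique_insert]
            exact ⟨hcl, fun b hb _ => (Finset.mem_filter.1 (hT hb)).2⟩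
          · rw [Finset.card_insert_of_notMem (hnot _ T hT), hcard]
        · exact Or.inr ⟨T, hsub _ T hT, hind, hcard⟩
      · rcases h₂ G ((A.erase v).filter fun x => ¬ G.Adj v x) (by omega) with
          ⟨T, hT, hcl, hcard⟩ | ⟨T, hT, hind, hcard⟩
        · exact Or.inl ⟨T, hsub _ T hT, hcl, hcard⟩
        · refine Or.inr ⟨insert v T, Finset.insert_subset hv (hsub _ T hT), ?_, ?_⟩
          · rw [Finset.coe_insert]
            refine Set.Pairwise.insert hind fun b hb _ => ?_
            have := (Finset.mem_filter.1 (hT hb)).2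
            exact ⟨this, fun h => this h.symm⟩
          · rw [Finset.card_insert_of_notMem (hnot _ T hT), hcard]

variable {W : Type u}

/-- In a graph without induced `K_{1,r}`, neighbourhoods have independence number below `r`. -/
theorem card_lt_of_starK_free {G : SimpleGraph W} {r : ℕ} (hr : ¬ (starK r).IsIndContained G)
    {x : W} {Y : Finset W} (hY : G.IsIndepSet Y) (hx : ∀ y ∈ Y, G.Adj x y) : Y.card < r := by
  by_contra! hc
  obtain ⟨Z, hZY, hZ⟩ := Finset.exists_subset_card_eq hc
  let e : Fin r ≃ Z := (Finset.equivFinOfCardEq hZ).symm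
  have hadj : ∀ i, G.Adj x (e i) := fun i => hx _ (hZY (e i).2)
  have hnadj : ∀ i j, ¬ G.Adj (e i : W) (e j) := fun i j h =>
    hY (hZY (e i).2) (hZY (e j).2) h.ne h
  refine hr ⟨⟨⟨Sum.elim (fun _ => x) (fun i => (e i : W)), ?_⟩, ?_⟩⟩
  · rintro (i | i) (j | j) h
    · rw [Subsingleton.elim i j]
    · exact ((hadj j).ne h).elim
    · exact ((hadj i).ne h.symm).elim
    · rw [e.injective (Subtype.ext h)]
  · rintro (i | i) (j | j)
    · show G.Adj x x ↔ _
      simp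
    · show G.Adj x (e j) ↔ _
      simp [hadj]
    · show G.Adj (e i) x ↔ _
      simp [(hadj i).symm]
    · show G.Adj (e i) (e j) ↔ _
      simp [hnadj]

/-- Private neighbours supply the pendant vertices. Neither injectivity of `y` nor disjointness of
its values from `T` is assumed: both follow from the adjacency conditions. -/
theorem hairyComplete_isIndContained {G : SimpleGraph W} {T : Finset W} (hT : G.IsClique T)
    {y : W → W} (hy : ∀ x ∈ T, ∀ x' ∈ T, G.Adj x' (y x) ↔ x = x')
    (hind : ∀ x ∈ T, ∀ x' ∈ T, ¬ G.Adj (y x) (y x')) :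
    (hairyComplete T.card).IsIndContained G := by
  let e : Fin T.card ≃ T := T.equivFin.symm
  have hadj : ∀ i j, G.Adj (e i) (y (e j)) ↔ i = j := fun i j => by
    rw [hy _ (e j).2 _ (e i).2, ← Subtype.ext_iff, e.injective.eq_iff, eq_comm]
  have hyx : ∀ i j, y (e i) ≠ e j := fun i j h => by
    have := (hadj j j).2 rfl
    exact hind _ (e i).2 _ (e j).2 (h ▸ this)
  refine ⟨⟨⟨Sum.elim (fun i => (e i : W)) (fun i => y (e i)), ?_⟩, ?_⟩⟩
  · rintro (i | i) (j | j) h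
    · rw [e.injective (Subtype.ext h)]
    · exact (hyx j i h.symm).elim
    · exact (hyx i j h).elim
    · have h1 := (hadj i i).2 rfl
      simp only [Sum.elim_inr] at h
      rw [h, hadj] at h1
      rw [h1]
  · rintro (i | i) (j | j)
    · show G.Adj (e i) (e j) ↔ i ≠ j
      refine ⟨fun h h' => h.ne (by rw [h']), fun h => hT (e i).2 (e j).2 fun h' => h ?_⟩
      exact e.injective (Subtype.ext h')
    · exact hadj i j
    · show G.Adj (y (e i)) (e j) ↔ i = j
      rw [G.adj_comm, hadj, eq_comm]
    · show G.Adj (y (e i)) (y (e j)) ↔ False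
      exact iff_false_intro (hind _ (e i).2 _ (e j).2)

/-- A connected graph without induced `P_l` has radius at every vertex below `l`. -/
theorem dist_lt_of_pathGraph_free {G : SimpleGraph W} (hG : G.Connected) {l : ℕ}
    (hl : ¬ (pathGraph l).IsIndContained G) (v w : W) : G.dist v w < l := by
  by_contra! hc
  obtain ⟨p, hp⟩ := hG.exists_walk_length_eq_dist v w
  -- On a geodesic the index is the distance from `v`, and adjacent vertices differ in distance by
  -- at most one; so the first `l` vertices induce a path.
  have hd : ∀ i ≤ p.length, G.dist v (p.getVert i) = i := by
    intro i hi
    have h1 := G.dist_le (p.take i)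
    have h2 := G.dist_le (p.drop i)
    have h3 := hG.dist_triangle (u := v) (v := p.getVert i) (w := w)
    rw [Walk.take_length] at h1
    rw [Walk.drop_length] at h2
    omega
  refine hl ⟨⟨⟨fun i => p.getVert i, fun i j h => ?_⟩, fun {i j} => ?_⟩⟩
  · have := congrArg (G.dist v) h
    simp only [] at this
    rw [hd _ (by omega), hd _ (by omega)] at this
    exact Fin.ext this
  · rw [pathGraph_adj]
    show G.Adj (p.getVert i) (p.getVert j) ↔ _
    constructor
    · intro h
      have h1 := h.diff_dist_adj (u := v)
      have h2 : G.dist v (p.getVert i) ≠ G.dist v (p.getVert j) ∨ (i : ℕ) = j := by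
        rw [hd _ (by omega), hd _ (by omega)]; omega
      have h3 : (i : ℕ) ≠ j := fun h' => h.ne (by rw [h'])
      rw [hd _ (by omega), hd _ (by omega)] at h1
      omega
    · rintro (h | h)
      · rw [← h]; exact p.adj_getVert_succ (by omega)
      · rw [← h]; exact (p.adj_getVert_succ (by omega)).symm

theorem Connected.exists_adj_dist_eq {G : SimpleGraph W} (hG : G.Connected) {v y : W} {i : ℕ}
    (hy : G.dist v y = i + 1) : ∃ x, G.dist v x = i ∧ G.Adj x y := by
  obtain ⟨p, hp⟩ := hG.exists_walk_length_eq_dist y v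
  rw [dist_comm, hy] at hp
  cases p with
  | nil => simp at hp
  | @cons _ x _ h q =>
    refine ⟨x, ?_, h.symm⟩
    have h1 := G.dist_le q
    have h2 := h.diff_dist_adj (u := v)
    rw [Walk.length_cons] at hp
    rw [dist_comm] at h1
    omega

/-- Independent sets inside a distance level are bounded in a connected graph that contains
neither `K_{1,r}` nor `K_s^h` as an induced subgraph. -/
theorem exists_bound_indepSet_level (r s i : ℕ) : ∃ a : ℕ, ∀ {W : Type u} [Finite W]
    (G : SimpleGraph W), G.Connected → ¬ (starK r).IsIndContained G →
      ¬ (hairyComplete s).IsIndContained G → ∀ (v : W) (Y : Finset W),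
        (∀ y ∈ Y, G.dist v y = i) → G.IsIndepSet Y → Y.card ≤ a := by
  classical
  induction i with
  | zero =>
    refine ⟨1, fun G hG _ _ v Y hY _ => Finset.card_le_one.2 fun a ha b hb => ?_⟩
    rw [← hG.dist_eq_zero_iff.1 (hY a ha), ← hG.dist_eq_zero_iff.1 (hY b hb)]
  | succ i ih =>
    obtain ⟨a, ha⟩ := ih
    obtain ⟨N, hN⟩ := exists_clique_or_indepSet.{u} s (a + 1)
    refine ⟨N * r, fun {W} _ G hG hr hs v Y hY hYind => ?_⟩
    have := Fintype.ofFinite W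
    -- `X` is an inclusion-minimal part of level `i` dominating `Y`; by minimality each of its
    -- vertices has a private neighbour in `Y`.
    obtain ⟨X, hXi, ⟨hXdom, hXmin⟩⟩ := exists_minimal_le_of_wellFoundedLT
      (fun X : Finset W => ∀ y ∈ Y, ∃ x ∈ X, G.Adj x y)
      (Finset.univ.filter fun x => G.dist v x = i) (fun y hy => by
        obtain ⟨x, hx, hxy⟩ := hG.exists_adj_dist_eq (hY y hy)
        exact ⟨x, by simp [hx], hxy⟩)
    have hpriv : ∀ x ∈ X, ∃ y ∈ Y, G.Adj x y ∧ ∀ x' ∈ X, G.Adj x' y → x = x' := by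
      intro x hx
      have h1 : ¬ ∀ y ∈ Y, ∃ x' ∈ X.erase x, G.Adj x' y := fun h =>
        Finset.notMem_erase x X (hXmin h (Finset.erase_subset x X) hx)
      push Not at h1
      obtain ⟨y, hy, hyx⟩ := h1
      have huniq : ∀ x' ∈ X, G.Adj x' y → x = x' := fun x' hx' h => by
        by_contra hne
        exact hyx x' (Finset.mem_erase.2 ⟨Ne.symm hne, hx'⟩) h
      obtain ⟨x', hx', hadj⟩ := hXdom y hy
      obtain rfl := huniq x' hx' hadj
      exact ⟨y, hy, hadj, huniq⟩
    -- A larger `X` would contain an `s`-clique, giving K_s^h through the private neighbours, or an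
    -- independent set exceeding the bound for level `i`.
    have hXN : X.card ≤ N := by
      by_contra! hc
      rcases hN G X hc.le with ⟨T, hTX, hT, hTs⟩ | ⟨T, hTX, hT, hTa⟩
      · choose! f hfY hfadj hfuniq using hpriv
        apply hs
        rw [← hTs]
        refine hairyComplete_isIndContained hT (y := f) (fun x hx x' hx' => ?_)
          (fun x hx x' hx' h => hYind (hfY x (hTX hx)) (hfY x' (hTX hx')) h.ne h)
        exact ⟨hfuniq x (hTX hx) x' (hTX hx'), fun h => h ▸ hfadj x (hTX hx)⟩
      · have := ha G hG hr hs v T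
          (fun y hy => (Finset.mem_filter.1 (hXi (hTX hy))).2) hT
        omega
    -- Each vertex of `X` sees fewer than `r` vertices of the independent set `Y`.
    have hcover : Y ⊆ X.biUnion fun x => Y.filter (G.Adj x) := fun y hy => by
      obtain ⟨x, hx, hxy⟩ := hXdom y hy
      exact Finset.mem_biUnion.2 ⟨x, hx, Finset.mem_filter.2 ⟨hy, hxy⟩⟩
    refine (Finset.card_le_card hcover).trans
      ((Finset.card_biUnion_le_card_mul _ _ r fun x _ => ?_).trans (Nat.mul_le_mul_right r hXN))
    exact (card_lt_of_starK_free hr (hYind.mono (by exact_mod_cast Finset.filter_subset _ _))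
      fun y hy => (Finset.mem_filter.1 hy).2).le

theorem exists_bound_indepSet (r s l : ℕ) : ∃ a : ℕ, ∀ {W : Type u} [Finite W]
    (G : SimpleGraph W), G.Connected → ¬ (starK r).IsIndContained G →
      ¬ (hairyComplete s).IsIndContained G → ¬ (pathGraph l).IsIndContained G →
        ∀ Y : Finset W, G.IsIndepSet Y → Y.card ≤ a := by
  classical
  choose f hf using exists_bound_indepSet_level.{u} r s
  refine ⟨∑ i ∈ Finset.range l, f i, fun G hG hr hs hl Y hY => ?_⟩
  obtain ⟨v⟩ := hG.nonempty
  rw [Finset.card_eq_sum_card_fiberwise (f := G.dist v) (t := Finset.range l)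
    fun y _ => by simpa using dist_lt_of_pathGraph_free hG hl v y]
  refine Finset.sum_le_sum fun i _ => hf i G hG hr hs v _ (fun y hy => ?_) (hY.mono
    (by exact_mod_cast Finset.filter_subset _ _))
  exact (Finset.mem_filter.1 hy).2

/-! ### Multiple domination and the colouring by traces. -/

/-- A maximal independent subset of a finite set dominates it. -/
theorem exists_indepSet_dominating (G : SimpleGraph W) (A : Finset W) :
    ∃ I ⊆ A, G.IsIndepSet I ∧ ∀ x ∈ A, x ∉ I → ∃ y ∈ I, G.Adj x y := by
  classical
  obtain ⟨I, hI⟩ := (A.powerset.filter fun I : Finset W => G.IsIndepSet I).exists_maximal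
    ⟨∅, by simp [IsIndepSet]⟩
  obtain ⟨hIA, hind⟩ := Finset.mem_filter.1 hI.prop
  rw [Finset.mem_powerset] at hIA
  refine ⟨I, hIA, hind, fun x hx hxI => ?_⟩
  by_contra! hc
  refine hxI (hI.le_of_ge (y := insert x I) ?_ (Finset.subset_insert x I)
    (Finset.mem_insert_self x I))
  rw [Finset.mem_filter, Finset.mem_powerset, Finset.coe_insert]
  exact ⟨Finset.insert_subset hx hIA,
    hind.insert fun b hb _ => ⟨hc b hb, fun h => hc b hb h.symm⟩⟩

/-- If independent sets have at most `a` vertices, there is a `k`-fold dominating set with at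
most `k * a` vertices. -/
theorem exists_multiple_dominating [Fintype W] [DecidableEq W] (G : SimpleGraph W)
    [DecidableRel G.Adj] {a : ℕ} (ha : ∀ Y : Finset W, G.IsIndepSet Y → Y.card ≤ a) (k : ℕ) :
    ∃ D : Finset W, D.card ≤ k * a ∧ ∀ x ∉ D, k ≤ (D.filter (G.Adj x)).card := by
  induction k with
  | zero => exact ⟨∅, by simp, by simp⟩
  | succ k ih =>
    obtain ⟨D, hD, hdom⟩ := ih
    -- A maximal independent set outside `D` gives every remaining vertex one neighbour not yet
    -- counted.
    obtain ⟨I, hID, hI, hIdom⟩ := exists_indepSet_dominating G Dᶜ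
    refine ⟨D ∪ I, (Finset.card_union_le _ _).trans ?_, fun x hx => ?_⟩
    · rw [Nat.succ_mul]
      exact add_le_add hD (ha I hI)
    · rw [Finset.mem_union, not_or] at hx
      obtain ⟨y, hy, hxy⟩ := hIdom x (Finset.mem_compl.2 hx.1) hx.2
      have hyD : y ∉ D.filter (G.Adj x) := fun h =>
        Finset.mem_compl.1 (hID hy) (Finset.mem_filter.1 h).1
      calc k + 1 ≤ (insert y (D.filter (G.Adj x))).card := by
            rw [Finset.card_insert_of_notMem hyD]
            exact Nat.succ_le_succ (hdom x hx.1)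
        _ ≤ _ := Finset.card_le_card (Finset.insert_subset
            (by simp [hy, hxy]) (Finset.filter_subset_filter _ Finset.subset_union_left))

/-- Take the union of geodesics from `v` to the vertices of `D`, each with at most `l` vertices; the
summand 1 pays for `v` when `D` is empty. -/
theorem exists_connected_subgraph_superset [Finite W] {G : SimpleGraph W} (hG : G.Connected)
    {l : ℕ} {v : W} (hl : ∀ w, G.dist v w < l) (D : Finset W) :
    ∃ H : G.Subgraph, H.Connected ∧ v ∈ H.verts ∧ (D : Set W) ⊆ H.verts ∧
      H.verts.ncard ≤ 1 + D.card * l := by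
  classical
  induction D using Finset.induction_on with
  | empty => exact ⟨G.singletonSubgraph v, Subgraph.singletonSubgraph_connected, by simp⟩
  | insert d D hd ih =>
    obtain ⟨H, hH, hv, hDH, hcard⟩ := ih
    obtain ⟨p, hp⟩ := hG.exists_walk_length_eq_dist v d
    refine ⟨H ⊔ p.toSubgraph, Subgraph.connected_sup hH.preconnected
      p.toSubgraph_connected.preconnected ⟨v, hv, p.start_mem_verts_toSubgraph⟩, Or.inl hv, ?_, ?_⟩
    · rw [Finset.coe_insert, Set.insert_subset_iff]
      exact ⟨Or.inr p.end_mem_verts_toSubgraph, fun x hx => Or.inl (hDH hx)⟩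
    · have h1 : p.toSubgraph.verts.ncard ≤ l := by
        have : p.toSubgraph.verts = (p.support.toFinset : Set W) := by
          ext; simp
        rw [this, Set.ncard_coe_finset]
        refine (List.toFinset_card_le _).trans ?_
        rw [Walk.length_support, hp]
        exact hl d
      rw [Finset.card_insert_of_notMem hd, Subgraph.verts_sup, Nat.succ_mul]
      have := Set.ncard_union_le H.verts p.toSubgraph.verts
      omega

/-- Attaching pendant edges to a connected subgraph. -/
theorem Subgraph.Connected.exists_attach [Finite W] {G : SimpleGraph W} {H : G.Subgraph}
    (hH : H.Connected) {f : W → W} (S : Finset W) (hf : ∀ x ∈ S, f x ∈ H.verts ∧ G.Adj x (f x)) :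
    ∃ K : G.Subgraph, K.Connected ∧ H ≤ K ∧ (S : Set W) ⊆ K.verts ∧
      ∀ e ∈ K.edgeSet, e ∈ H.edgeSet ∨ ∃ x ∈ S, e = s(x, f x) := by
  classical
  induction S using Finset.induction_on with
  | empty => exact ⟨H, hH, le_rfl, by simp, fun e he => Or.inl he⟩
  | insert x S _ ih =>
    obtain ⟨K, hK, hHK, hS, hedge⟩ := ih fun y hy => hf y (Finset.mem_insert_of_mem hy)
    obtain ⟨hx, hadj⟩ := hf x (Finset.mem_insert_self x S)
    refine ⟨K ⊔ G.subgraphOfAdj hadj, connected_sup hK.preconnected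
      (subgraphOfAdj_connected hadj).preconnected ⟨f x, hHK.1 hx, by simp⟩,
      hHK.trans le_sup_left, ?_, ?_⟩
    · rw [Finset.coe_insert, Set.insert_subset_iff]
      exact ⟨Or.inr (by simp), fun y hy => Or.inl (hS hy)⟩
    · intro e he
      rw [edgeSet_sup, edgeSet_subgraphOfAdj] at he
      rcases he with he | he
      · rcases hedge e he with h | ⟨y, hy, h⟩
        · exact Or.inl h
        · exact Or.inr ⟨y, Finset.mem_insert_of_mem hy, h⟩
      · exact Or.inr ⟨x, Finset.mem_insert_self x S, he⟩

/-- A connected subgraph whose vertex set dominates every other vertex `k` times gives a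
`k`-rainbow colouring: colour each edge by the set of its ends in the subgraph. -/
theorem rainbowIndex_le_of_dominating [Finite W] {G : SimpleGraph W} {H : G.Subgraph}
    (hH : H.Connected) {k : ℕ} (hdom : ∀ x ∉ H.verts, k ≤ {y ∈ H.verts | G.Adj x y}.ncard) :
    rainbowIndex k G ≤ 2 ^ H.verts.ncard := by
  classical
  have := Fintype.ofFinite W
  have hK : Nat.card (Set H.verts) = 2 ^ H.verts.ncard := by
    rw [Nat.card_eq_fintype_card, Fintype.card_set, Set.ncard_eq_toFinset_card',
      Set.toFinset_card]
  -- Edges of `H` get two-element sets, edges leaving `H.verts` get singletons.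
  let c : G.edgeSet → Set H.verts := fun e => {x | (x : W) ∈ (e : Sym2 W)}
  have hc : ∀ e f : G.edgeSet, c e = c f →
      ∀ x ∈ H.verts, x ∈ (e : Sym2 W) → x ∈ (f : Sym2 W) := by
    intro e f h x hx hxe
    have : (⟨x, hx⟩ : H.verts) ∈ c f := h ▸ hxe
    exact this
  rw [← hK]
  refine rainbowIndex_le_card (c := c) (isRainbowColoring_of_connected fun S hS => ?_)
  -- Hall's condition is immediate: a nonempty family has at most `k` members, and any single one
  -- already has `k` neighbours in `H`. The result is a choice of distinct attachment vertices.
  obtain ⟨g, hginj, hg⟩ := (Finset.all_card_le_biUnion_card_iff_exists_injective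
    (fun x : {x // x ∈ S ∧ x ∉ H.verts} =>
      Finset.univ.filter fun y => y ∈ H.verts ∧ G.Adj x y)).1 (by
    intro s
    rcases s.eq_empty_or_nonempty with rfl | ⟨x, hx⟩
    · simp
    · calc s.card ≤ S.card := by
            rw [← Finset.card_map (Function.Embedding.subtype _)]
            refine Finset.card_le_card fun y hy => ?_
            obtain ⟨z, -, rfl⟩ := Finset.mem_map.1 hy
            exact z.2.1
        _ ≤ (Finset.univ.filter fun y => y ∈ H.verts ∧ G.Adj x y).card := by
            rw [hS]
            refine (hdom x x.2.2).trans_eq ?_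
            rw [← Set.ncard_coe_finset]
            congr 1
            ext; simp
        _ ≤ _ := Finset.card_le_card (Finset.subset_biUnion_of_mem
            (fun x : {x // x ∈ S ∧ x ∉ H.verts} =>
              Finset.univ.filter fun y => y ∈ H.verts ∧ G.Adj x y) hx))
  let f : W → W := fun x => if h : x ∈ S ∧ x ∉ H.verts then g ⟨x, h⟩ else x
  have hfx : ∀ x (h : x ∈ S ∧ x ∉ H.verts), f x = g ⟨x, h⟩ := fun x h => dif_pos h
  have hfinj : ∀ x ∈ S.filter (· ∉ H.verts), ∀ y ∈ S.filter (· ∉ H.verts), f x = f y → x = y := by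
    intro x hx y hy h
    rw [Finset.mem_filter] at hx hy
    rw [hfx x hx, hfx y hy] at h
    exact congrArg Subtype.val (hginj h)
  have hf : ∀ x ∈ S.filter (· ∉ H.verts), f x ∈ H.verts ∧ G.Adj x (f x) := by
    intro x hx
    rw [Finset.mem_filter] at hx
    rw [hfx x hx]
    exact (Finset.mem_filter.1 (hg ⟨x, hx⟩)).2
  obtain ⟨K, hKconn, hHK, hSK, hedge⟩ := hH.exists_attach _ hf
  refine ⟨K, hKconn, fun x hx => ?_, ?_⟩
  · by_cases h : x ∈ H.verts
    · exact hHK.1 h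
    · exact hSK (by simpa [h] using hx)
  · have hin : ∀ e ∈ H.edgeSet, ∀ x ∈ e, x ∈ H.verts := fun e he x hx =>
      H.mem_verts_of_mem_edge he hx
    rintro ⟨e, he⟩ ⟨e', he'⟩ heK heK' h
    have h1 := hc _ _ h
    have h2 := hc _ _ h.symm
    simp only at h1 h2 heK heK'
    apply Subtype.ext
    show e = e'
    -- An edge of `H` is determined by its colour, a pair is never a singleton, and two pendant
    -- edges with one attachment vertex coincide by injectivity.
    rcases hedge e heK with hH1 | ⟨x, hx, rfl⟩ <;> rcases hedge e' heK' with hH2 | ⟨y, hy, rfl⟩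
    · exact Sym2.ext fun z => ⟨fun hz => h1 z (hin _ hH1 z hz) hz, fun hz =>
        h2 z (hin _ hH2 z hz) hz⟩
    · induction e using Sym2.ind with
      | _ a b =>
        have ha := h1 a (hin _ hH1 a (by simp)) (by simp)
        have hb := h1 b (hin _ hH1 b (by simp)) (by simp)
        have hy' := (Finset.mem_filter.1 hy).2
        have hab : a ≠ b := G.ne_of_adj he
        have haV := hin _ hH1 a (by simp)
        have hbV := hin _ hH1 b (by simp)
        simp only [Sym2.mem_iff] at ha hb
        grind
    · induction e' using Sym2.ind with
      | _ a b =>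
        have ha := h2 a (hin _ hH2 a (by simp)) (by simp)
        have hb := h2 b (hin _ hH2 b (by simp)) (by simp)
        have hx' := (Finset.mem_filter.1 hx).2
        have hab : a ≠ b := G.ne_of_adj he'
        have haV := hin _ hH2 a (by simp)
        have hbV := hin _ hH2 b (by simp)
        simp only [Sym2.mem_iff] at ha hb
        grind
    · have h3 := h1 (f x) (hf x hx).1 (by simp)
      have hy' := (Finset.mem_filter.1 hy).2
      rw [Sym2.mem_iff] at h3
      rcases h3 with h3 | h3
      · exact (hy' (h3 ▸ (hf x hx).1)).elim
      · rw [hfinj x hx y hy h3]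

/-- The `3`-rainbow index of connected graphs without induced `K_{1,r}`, `K_s^h` and `P_l` is
bounded. -/
theorem exists_bound_rainbowIndex (r s l : ℕ) : ∃ C : ℕ, ∀ (W : Type u) [Finite W]
    (G : SimpleGraph W), G.Connected → ¬ (starK r).IsIndContained G →
      ¬ (hairyComplete s).IsIndContained G → ¬ (pathGraph l).IsIndContained G →
        rainbowIndex 3 G ≤ C := by
  classical
  obtain ⟨a, ha⟩ := exists_bound_indepSet.{u} r s l
  refine ⟨2 ^ (1 + 3 * a * l), fun W _ G hG hr hs hl => ?_⟩
  have := Fintype.ofFinite W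
  -- `D` has at most `3 * a` vertices, so the connected subgraph has at most `1 + 3 * a * l`; this
  -- is the exponent.
  obtain ⟨D, hD, hdom⟩ := exists_multiple_dominating G (ha G hG hr hs hl) 3
  obtain ⟨v⟩ := hG.nonempty
  obtain ⟨H, hH, -, hDH, hcard⟩ :=
    exists_connected_subgraph_superset hG (dist_lt_of_pathGraph_free hG hl v) D
  refine (rainbowIndex_le_of_dominating hH fun x hx => (hdom x fun h => hx (hDH h)).trans ?_).trans
    (Nat.pow_le_pow_right (by norm_num) (hcard.trans ?_))
  · rw [← Set.ncard_coe_finset]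
    refine Set.ncard_le_ncard (fun y hy => ?_) (Set.toFinite _)
    have := Finset.mem_filter.1 hy
    exact ⟨hDH this.1, this.2⟩
  · exact Nat.add_le_add_left (Nat.mul_le_mul_right l hD) 1

end SimpleGraph

namespace SimpleGraph

variable {V W : Type*}

/-! ### Recognising stars and paths -/

theorem nonempty_iso_starK_of_center [Finite V] {H : SimpleGraph V} {c : V}
    (hc : ∀ a b, H.Adj a b ↔ (a = c ∧ b ≠ c) ∨ (a ≠ c ∧ b = c)) :
    Nonempty (H ≃g starK (Nat.card V - 1)) := by
  classical
  have := Fintype.ofFinite V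
  have hcard : Fintype.card {a // ¬ a = c} = Nat.card V - 1 := by
    rw [Fintype.card_subtype_compl, Fintype.card_subtype_eq, Nat.card_eq_fintype_card]
  let e : Fin 1 ⊕ Fin (Nat.card V - 1) ≃ V :=
    (Equiv.sumCongr (Equiv.ofUnique (Fin 1) {a // a = c})
      (Fintype.equivFinOfCardEq hcard).symm).trans (Equiv.sumCompl (· = c))
  have hl : ∀ i, e (Sum.inl i) = c := fun i => (Equiv.ofUnique (Fin 1) {a // a = c} i).2
  have hr : ∀ i, e (Sum.inr i) ≠ c := fun i => ((Fintype.equivFinOfCardEq hcard).symm i).2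
  refine ⟨Iso.symm ⟨e, ?_⟩⟩
  rintro (i | i) (j | j) <;> simp [hc, hl, hr]

/-- Connectedness provides an edge, and every edge of a star meets its centre, so the centre lies in
the image. -/
theorem nonempty_iso_starK_of_isIndContained [Finite V] {H : SimpleGraph V} (hH : H.Connected)
    (hcard : 2 ≤ Nat.card V) {n : ℕ} (h : H.IsIndContained (starK n)) :
    Nonempty (H ≃g starK (Nat.card V - 1)) := by
  obtain ⟨φ⟩ := h
  have := (Nat.card_pos_iff.1 (by omega : 0 < Nat.card V)).1
  have : Nontrivial V := Finite.one_lt_card_iff_nontrivial.1 hcard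
  obtain ⟨a⟩ := hH.nonempty
  obtain ⟨b, hab⟩ := hH.preconnected.exists_adj_of_nontrivial a
  obtain ⟨c, hc⟩ : ∃ c, φ c = Sum.inl 0 := by
    have h' := φ.map_adj_iff.2 hab
    rcases ha : φ a with i | i
    · exact ⟨a, by rw [ha, Subsingleton.elim i 0]⟩
    · rcases hb : φ b with j | j
      · exact ⟨b, by rw [hb, Subsingleton.elim j 0]⟩
      · rw [ha, hb] at h'
        simp at h'
  refine nonempty_iso_starK_of_center (c := c) fun a b => ?_
  rw [← φ.map_adj_iff, ← φ.injective.eq_iff (a := a), ← φ.injective.eq_iff (a := b), Ne, Ne,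
    ← φ.injective.eq_iff (a := a), ← φ.injective.eq_iff (a := b), hc]
  rcases φ a with i | i <;> rcases φ b with j | j <;> simp [Fin.fin_one_eq_zero]

/-- A finite connected graph whose vertices are numbered so that adjacency means consecutive
numbers is a path. -/
theorem nonempty_iso_pathGraph_of_numbering [Finite V] {H : SimpleGraph V} (hH : H.Connected)
    {f : V → ℕ} (hf : Function.Injective f)
    (hadj : ∀ a b, H.Adj a b ↔ f a + 1 = f b ∨ f b + 1 = f a) :
    Nonempty (H ≃g pathGraph (Nat.card V)) := by
  classical
  have := Fintype.ofFinite V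
  have := hH.nonempty
  obtain ⟨m, hm⟩ := Finite.exists_min f
  -- Values change by one along edges, so a connected graph cannot jump over a missing value; the
  -- numbers used form an interval.
  have hfill : ∀ b k, f m ≤ k → k ≤ f b → ∃ c, f c = k := by
    intro b k hmk hkb
    by_contra! hc
    have : ∀ a, f a < k := fun a => hH.forall_of_adj_closed (P := fun a => f a < k)
      (fun a b hab ha => by
        have := hc b
        rcases (hadj a b).1 hab with h | h <;> omega) (lt_of_le_of_ne hmk (hc m)) a
    exact absurd (this b) (by omega)
  have hlt : ∀ b, f b - f m < Nat.card V := by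
    intro b
    have hsub : Finset.Icc (f m) (f b) ⊆ Finset.univ.image f := fun k hk => by
      rw [Finset.mem_Icc] at hk
      obtain ⟨c, hc⟩ := hfill b k hk.1 hk.2
      exact Finset.mem_image.2 ⟨c, Finset.mem_univ c, hc⟩
    have := (Finset.card_le_card hsub).trans Finset.card_image_le
    rw [Nat.card_Icc, Finset.card_univ] at this
    rw [Nat.card_eq_fintype_card]
    have := hm b
    omega
  let g : V → Fin (Nat.card V) := fun b => ⟨f b - f m, hlt b⟩
  have hg : Function.Injective g := fun a b h => hf (by
    have h' : f a - f m = f b - f m := congrArg Fin.val h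
    have := hm a
    have := hm b
    omega)
  have hbij : Function.Bijective g :=
    (Fintype.bijective_iff_injective_and_card g).2 ⟨hg, by simp⟩
  refine ⟨⟨Equiv.ofBijective g hbij, fun {a b} => ?_⟩⟩
  rw [hadj, pathGraph_adj]
  show f a - f m + 1 = f b - f m ∨ f b - f m + 1 = f a - f m ↔ _
  have := hm a
  have := hm b
  omega

/-- Replaces modular subtraction by linear arithmetic that `omega` can decide. -/
theorem cycleGraph_adj_iff_val {n : ℕ} (hn : 3 ≤ n) (i j : Fin n) :
    (cycleGraph n).Adj i j ↔ (i : ℕ) + 1 = j ∨ (j : ℕ) + 1 = i ∨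
      ((i : ℕ) = 0 ∧ (j : ℕ) + 1 = n) ∨ ((j : ℕ) = 0 ∧ (i : ℕ) + 1 = n) := by
  have hsub : ∀ a b : Fin n, ((a - b : Fin n) : ℕ) = if (b : ℕ) ≤ a then (a : ℕ) - b
      else n - b + a := by
    intro a b
    rw [Fin.val_sub]
    split_ifs with h
    · rw [show n - (b : ℕ) + a = (a - b) + n by omega, Nat.add_mod_right, Nat.mod_eq_of_lt]
      omega
    · exact Nat.mod_eq_of_lt (by omega)
  rw [cycleGraph_adj', hsub, hsub]
  split_ifs <;> omega

/-- A connected induced subgraph of a cycle that misses a vertex is a path. -/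
theorem nonempty_iso_pathGraph_of_isIndContained_cycleGraph [Finite V] {H : SimpleGraph V}
    (hH : H.Connected) {n : ℕ} (hn : 3 ≤ n) (hcard : Nat.card V < n)
    (h : H.IsIndContained (cycleGraph n)) : Nonempty (H ≃g pathGraph (Nat.card V)) := by
  obtain ⟨φ⟩ := h
  obtain ⟨v, hv⟩ : ∃ v, ∀ a, φ a ≠ v := by
    by_contra! hc
    have := Nat.card_le_card_of_surjective φ hc
    simp at this
    omega
  have hv' : ∀ a, (φ a : ℕ) ≠ v := fun a h => hv a (Fin.ext h)
  refine nonempty_iso_pathGraph_of_numbering hH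
    -- Cut the cycle at the missed vertex `v` and count onward from its successor.
    (f := fun a => if (v : ℕ) < φ a then (φ a : ℕ) - v - 1 else φ a + n - v - 1)
    (fun a b hab => φ.injective (Fin.ext ?_)) fun a b => ?_
  · have := hv' a
    have := hv' b
    simp only at hab
    split_ifs at hab <;> omega
  · rw [← φ.map_adj_iff, cycleGraph_adj_iff_val hn]
    have := hv' a
    have := hv' b
    split_ifs <;> omega

/-! ### Stars and complete graphs with pendant edges -/

theorem starK_adj_inr {r : ℕ} (i : Fin r) (x : Fin 1 ⊕ Fin r) :
    (starK r).Adj (Sum.inr i) x ↔ x = Sum.inl 0 := by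
  rcases x with j | j
  · simp [Subsingleton.elim j 0]
  · simp

theorem starK_exists_walk {r : ℕ} (x y : Fin 1 ⊕ Fin r) :
    ∃ p : (starK r).Walk x y, p.length ≤ 2 := by
  have key : ∀ x : Fin 1 ⊕ Fin r, ∃ p : (starK r).Walk x (Sum.inl 0), p.length ≤ 1 := by
    rintro (i | i)
    · rw [Subsingleton.elim i 0]
      exact ⟨.nil, by simp⟩
    · exact ⟨.cons ((starK_adj_inr i _).2 rfl) .nil, by simp⟩
  obtain ⟨p, hp⟩ := key x
  obtain ⟨q, hq⟩ := key y
  exact ⟨p.append q.reverse, by rw [Walk.length_append, Walk.length_reverse]; omega⟩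

theorem hairyComplete_adj_inr {s : ℕ} (i : Fin s) (x : Fin s ⊕ Fin s) :
    (hairyComplete s).Adj (Sum.inr i) x ↔ x = Sum.inl i := by
  rcases x with j | j
  · show i = j ↔ _
    rw [Sum.inl.injEq, eq_comm]
  · show False ↔ _
    simp

theorem hairyComplete_exists_walk {s : ℕ} (x y : Fin s ⊕ Fin s) :
    ∃ p : (hairyComplete s).Walk x y, p.length ≤ 3 := by
  have key : ∀ x : Fin s ⊕ Fin s, ∃ i,
      ∃ p : (hairyComplete s).Walk x (Sum.inl i), p.length ≤ 1 := by
    rintro (i | i)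
    · exact ⟨i, .nil, by simp⟩
    · exact ⟨i, .cons ((hairyComplete_adj_inr i _).2 rfl) .nil, by simp⟩
  have mid : ∀ i j, ∃ p : (hairyComplete s).Walk (Sum.inl i) (Sum.inl j), p.length ≤ 1 := by
    intro i j
    rcases eq_or_ne i j with rfl | hne
    · exact ⟨.nil, by simp⟩
    · exact ⟨.cons (show (hairyComplete s).Adj (.inl i) (.inl j) from hne) .nil, by simp⟩
  obtain ⟨i, p, hp⟩ := key x
  obtain ⟨j, q, hq⟩ := key y
  obtain ⟨m, hm⟩ := mid i j
  exact ⟨p.append (m.append q.reverse), by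
    rw [Walk.length_append, Walk.length_append, Walk.length_reverse]; omega⟩

/-- Estimates made on concrete models have to be carried to isomorphic copies in another universe.
-/
theorem Iso.exists_walk_length_le {H : SimpleGraph V} {G : SimpleGraph W} (e : H ≃g G) {m : ℕ}
    (h : ∀ x y, ∃ p : H.Walk x y, p.length ≤ m) (x y : W) : ∃ p : G.Walk x y, p.length ≤ m := by
  obtain ⟨p, hp⟩ := h (e.symm x) (e.symm y)
  exact ⟨(p.map e.toHom).copy (e.apply_symm_apply x) (e.apply_symm_apply y), by simpa using hp⟩

theorem Iso.le_rainbowIndex_of_pendant [Finite W] {H : SimpleGraph V} {G : SimpleGraph W}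
    (e : H ≃g G) (hG : G.Connected) (hW : 3 ≤ Nat.card W) {n : ℕ} {u w : Fin n → V}
    (hu : Function.Injective u) (huw : ∀ i j, u i ≠ w j)
    (hadj : ∀ i x, H.Adj (u i) x ↔ x = w i) : n ≤ rainbowIndex 3 G := by
  refine card_le_rainbowIndex_of_pendant hG hW (u := e ∘ u) (w := e ∘ w) (e.injective.comp hu)
    (fun i j h => huw i j (e.injective h)) fun i x => ?_
  obtain ⟨x, rfl⟩ := e.surjective x
  simp [e.map_adj_iff, hadj]

theorem connected_of_exists_walk [Nonempty V] {H : SimpleGraph V} {m : ℕ}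
    (h : ∀ x y, ∃ p : H.Walk x y, p.length ≤ m) : H.Connected :=
  ⟨fun x y => ⟨(h x y).choose⟩⟩

/-! ### Cycles -/

/-- A sequence of `n` colours with at least three repetitions has two cut points such that
omitting any one of the three cyclic gaps leaves a repetition. -/
theorem exists_cuts_of_coloring {n k : ℕ} (hk : k + 3 ≤ n) (col : ℕ → Fin k) :
    ∃ a b, 0 < a ∧ a < b ∧ b < n ∧
      (∃ i j, i < j ∧ j < b ∧ col i = col j) ∧
      (∃ i j, a ≤ i ∧ i < j ∧ j < n ∧ col i = col j) ∧
      (∃ i j, i < j ∧ j < n ∧ (i < a ∨ b ≤ i) ∧ (j < a ∨ b ≤ j) ∧ col i = col j) := by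
  classical
  have pig : ∀ A : Finset ℕ, k < A.card → ∃ i ∈ A, ∃ j ∈ A, i < j ∧ col i = col j := by
    intro A hA
    obtain ⟨i, hi, j, hj, hne, h⟩ := Finset.exists_ne_map_eq_of_card_lt_of_maps_to
      (s := A) (t := Finset.univ) (by simpa using hA) (f := col) (fun _ _ => by simp)
    rcases lt_or_gt_of_ne hne with hlt | hlt
    · exact ⟨i, hi, j, hj, hlt, h⟩
    · exact ⟨j, hj, i, hi, hlt, h.symm⟩
  -- `B b`: the first `b` colours contain a repetition. `A d`: the last `d` colours do. Both are
  -- used at their minimal values.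
  let B : ℕ → Prop := fun b => ∃ i j, i < j ∧ j < b ∧ col i = col j
  let A : ℕ → Prop := fun d => ∃ i j, n ≤ i + d ∧ i < j ∧ j < n ∧ col i = col j
  have hB : B (n - 2) := by
    obtain ⟨i, hi, j, hj, hij, h⟩ := pig (Finset.range (n - 2)) (by simp; omega)
    exact ⟨i, j, hij, by simpa using hj, h⟩
  have hA : A (n - 2) := by
    obtain ⟨i, hi, j, hj, hij, h⟩ := pig (Finset.Ico 2 n) (by simp; omega)
    rw [Finset.mem_Ico] at hi hj
    exact ⟨i, j, by omega, hij, hj.2, h⟩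
  have hexB : ∃ b, B b := ⟨_, hB⟩
  have hexA : ∃ d, A d := ⟨_, hA⟩
  obtain ⟨b, hb, hbmin⟩ : ∃ b, B b ∧ ∀ b' < b, ¬ B b' :=
    ⟨Nat.find hexB, Nat.find_spec hexB, fun _ h => Nat.find_min hexB h⟩
  obtain ⟨d, hd, hdmin⟩ : ∃ d, A d ∧ ∀ d' < d, ¬ A d' :=
    ⟨Nat.find hexA, Nat.find_spec hexA, fun _ h => Nat.find_min hexA h⟩
  have hbn : b ≤ n - 2 := not_lt.1 fun h => hbmin _ h hB
  have hdn : d ≤ n - 2 := not_lt.1 fun h => hdmin _ h hA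
  obtain ⟨i₁, j₁, h₁, h₁', hc₁⟩ := hb
  obtain ⟨i₂, j₂, h₂, h₂', h₂'', hc₂⟩ := hd
  by_cases hcase : b ≤ n - d
  -- The repeating prefix and suffix are disjoint; the middle gap can be a single position, whose
  -- omission leaves `n - 1` colours.
  · refine ⟨n - d, n - d + 1, by omega, by omega, by omega, ⟨i₁, j₁, h₁, by omega, hc₁⟩,
      ⟨i₂, j₂, by omega, h₂', h₂'', hc₂⟩, ?_⟩
    obtain ⟨i, hi, j, hj, hij, h⟩ := pig ((Finset.range n).erase (n - d)) (by
      rw [Finset.card_erase_of_mem (Finset.mem_range.2 (by omega)), Finset.card_range]; omega)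
    rw [Finset.mem_erase, Finset.mem_range] at hi hj
    exact ⟨i, j, hij, hj.2, by omega, by omega, h⟩
  · refine ⟨n - d, b, by omega, by omega, by omega, ⟨i₁, j₁, h₁, h₁', hc₁⟩,
      ⟨i₂, j₂, by omega, h₂', h₂'', hc₂⟩, ?_⟩
    -- Prefix and suffix overlap. Drop the first position of the suffix and the last of the prefix:
    -- at least `n - 2` positions remain, and minimality of `b` and `d` forces the repetition found
    -- there to straddle the middle gap.
    obtain ⟨i, hi, j, hj, hij, h⟩ := pig (((Finset.range n).erase (n - d)).erase (b - 1)) (by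
      have h1 := Finset.pred_card_le_card_erase (s := (Finset.range n).erase (n - d)) (a := b - 1)
      rw [Finset.card_erase_of_mem (Finset.mem_range.2 (by omega)), Finset.card_range] at h1
      omega)
    simp only [Finset.mem_erase, Finset.mem_range] at hi hj
    have hjb : b ≤ j := by
      by_contra! hlt
      exact hbmin (b - 1) (by omega) ⟨i, j, hij, by omega, h⟩
    have hia : i < n - d := by
      by_contra! hle
      exact hdmin (d - 1) (by omega) ⟨i, j, by omega, hij, hj.2.2, h⟩
    exact ⟨i, j, hij, hj.2.2, Or.inl hia, Or.inr hjb, h⟩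

section Cycle

variable {n : ℕ} {G : SimpleGraph W}

/-- A connected subgraph of a cycle missing two edges cannot meet both remaining arcs. -/
theorem not_meets_both_arcs (hn : 3 ≤ n) (e : cycleGraph n ≃g G) {T : G.Subgraph}
    (hT : T.Connected) {nx : Fin n → Fin n}
    (hnx : ∀ i, (nx i : ℕ) = if (i : ℕ) + 1 = n then 0 else (i : ℕ) + 1) {i j a b : Fin n}
    (hi : ¬ T.Adj (e i) (e (nx i))) (hj : ¬ T.Adj (e j) (e (nx j)))
    (hia : i < a) (haj : a ≤ j) (hb : b ≤ i ∨ j < b) (ha : e a ∈ T.verts) (hb' : e b ∈ T.verts) :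
    False := by
  -- The only cycle edges leaving the arc from `i + 1` to `j` are the two missing ones.
  have h := hT.forall_of_adj_closed (P := fun w => i < e.symm w ∧ e.symm w ≤ j) ?_ ha
    (by simpa using ⟨hia, haj⟩) hb'
  · simp only [RelIso.symm_apply_apply] at h
    rcases hb with hb | hb
    · exact absurd h.1 (not_lt.2 hb)
    · exact absurd h.2 (not_le.2 hb)
  · intro x y hxy hx
    obtain ⟨x, rfl⟩ := e.surjective x
    obtain ⟨y, rfl⟩ := e.surjective y
    simp only [RelIso.symm_apply_apply] at hx ⊢
    have hadj := (cycleGraph_adj_iff_val hn x y).1 (e.map_adj_iff.1 hxy.adj_sub)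
    have h1 : ¬ (y = i ∧ x = nx i) := by
      rintro ⟨rfl, rfl⟩
      exact hi hxy.symm
    have h2 : ¬ (x = j ∧ y = nx j) := by
      rintro ⟨rfl, rfl⟩
      exact hj hxy
    simp only [Fin.ext_iff, hnx, Fin.lt_def, Fin.le_def] at h1 h2 hx ⊢
    split_ifs at h1 h2 <;> omega

/-- A connected subgraph through three vertices of a cycle contains two of the three arcs between
them. With at most `n - 3` colours, the vertices can be placed so that any two arcs together repeat
a colour. -/
theorem le_rainbowIndex_of_iso_cycleGraph [Finite W] (hn : 3 ≤ n) (e : cycleGraph n ≃g G)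
    (hG : G.Connected) : n ≤ rainbowIndex 3 G + 2 := by
  classical
  by_contra! hlt
  obtain ⟨c, hc⟩ := hG.exists_rainbowIndex_coloring 3
  let nx : Fin n → Fin n := fun i => ⟨if (i : ℕ) + 1 = n then 0 else i + 1, by split_ifs <;> omega⟩
  have hnx : ∀ i, (nx i : ℕ) = if (i : ℕ) + 1 = n then 0 else (i : ℕ) + 1 := fun i => rfl
  have hadj : ∀ i, G.Adj (e i) (e (nx i)) := fun i => e.map_adj_iff.2 <|
    (cycleGraph_adj_iff_val hn _ _).2 (by rw [hnx]; split_ifs <;> omega)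
  let E : Fin n → G.edgeSet := fun i => ⟨s(e i, e (nx i)), hadj i⟩
  have hE : Function.Injective E := by
    intro i j h
    have h' : s(e i, e (nx i)) = s(e j, e (nx j)) := congrArg Subtype.val h
    rcases Sym2.eq_iff.1 h' with ⟨h1, -⟩ | ⟨h1, h2⟩
    · exact e.injective h1
    · have h1 := congrArg Fin.val (e.injective h1)
      have h2 := congrArg Fin.val (e.injective h2)
      rw [hnx] at h1 h2
      apply Fin.ext
      split_ifs at h1 h2 <;> omega
  -- Extends the edge numbering to all of `ℕ`, as the cut lemma expects; only indices below `n`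
  -- matter.
  let v : ℕ → Fin n := fun i => ⟨i % n, Nat.mod_lt _ (by omega)⟩
  have hv : ∀ i < n, (v i : ℕ) = i := fun i hi => Nat.mod_eq_of_lt hi
  obtain ⟨a, b, ha, hab, hb, ⟨i₁, j₁, h₁, h₁', hc₁⟩, ⟨i₂, j₂, h₂, h₂', h₂'', hc₂⟩,
    ⟨i₃, j₃, h₃, h₃', h₃i, h₃j, hc₃⟩⟩ := exists_cuts_of_coloring hlt (fun i => c (E (v i)))
  have hne : ∀ i < n, ∀ j < n, i ≠ j → e (v i) ≠ e (v j) := fun i hi j hj hij h => hij (by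
    rw [← hv i hi, ← hv j hj, e.injective h])
  obtain ⟨T, ⟨hT, hS⟩, hr⟩ := hc {e (v 0), e (v a), e (v b)} (by
    rw [Finset.card_eq_three]
    exact ⟨_, _, _, hne 0 (by omega) a (by omega) (by omega),
      hne 0 (by omega) b hb (by omega), hne a (by omega) b hb (by omega), rfl⟩)
  have hT' : T.Connected := ⟨hT.connected⟩
  have h0T : e (v 0) ∈ T.verts := hS (by simp)
  have haT : e (v a) ∈ T.verts := hS (by simp)
  have hbT : e (v b) ∈ T.verts := hS (by simp)
  have hrep : ∀ i j, i < j → j < n → c (E (v i)) = c (E (v j)) →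
      T.Adj (e (v i)) (e (nx (v i))) → T.Adj (e (v j)) (e (nx (v j))) → False := by
    intro i j hij hj h hi' hj'
    have := congrArg Fin.val (hE (hr (E (v i)) (E (v j)) hi' hj' h))
    rw [hv i (by omega), hv j hj] at this
    omega
  have hcut : ∀ i j x y, i < x → x ≤ j → j < n → y < n → (y ≤ i ∨ j < y) →
      e (v x) ∈ T.verts → e (v y) ∈ T.verts →
      T.Adj (e (v i)) (e (nx (v i))) ∨ T.Adj (e (v j)) (e (nx (v j))) := by
    intro i j x y hix hxj hj hy hyi hx hy'
    by_contra! hcon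
    refine not_meets_both_arcs hn e hT' hnx hcon.1 hcon.2 (a := v x) (b := v y) ?_ ?_ ?_ hx hy'
    · rw [Fin.lt_def, hv _ (by omega), hv _ (by omega)]; exact hix
    · rw [Fin.le_def, hv _ (by omega), hv _ (by omega)]; exact hxj
    · rw [Fin.le_def, Fin.lt_def, hv _ (by omega), hv _ (by omega), hv _ (by omega)]; exact hyi
  -- The whole arc from `x` to `y` lies in `T`. Of any two of the three arcs one is full, since two
  -- gaps would separate the chosen vertices.
  let full : ℕ → ℕ → Prop := fun x y => ∀ i, x ≤ i → i < y → T.Adj (e (v i)) (e (nx (v i)))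
  have h12 : full 0 a ∨ full a b := by
    by_contra! hcon
    simp only [full, not_forall] at hcon
    obtain ⟨⟨i, hi, hi', hiT⟩, ⟨j, hj, hj', hjT⟩⟩ := hcon
    exact (hcut i j a b hi' hj (by omega) hb (Or.inr hj') haT hbT).elim hiT hjT
  have h13 : full 0 a ∨ full b n := by
    by_contra! hcon
    simp only [full, not_forall] at hcon
    obtain ⟨⟨i, hi, hi', hiT⟩, ⟨j, hj, hj', hjT⟩⟩ := hcon
    exact (hcut i j a 0 hi' (by omega) hj' (by omega) (Or.inl hi) haT h0T).elim hiT hjT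
  have h23 : full a b ∨ full b n := by
    by_contra! hcon
    simp only [full, not_forall] at hcon
    obtain ⟨⟨i, hi, hi', hiT⟩, ⟨j, hj, hj', hjT⟩⟩ := hcon
    exact (hcut i j b 0 hi' hj hj' (by omega) (Or.inl (by omega)) hbT h0T).elim hiT hjT
  have hAB : full 0 a → full a b → False := fun hA hB => by
    have hf : full 0 b := fun i _ hi => (lt_or_ge i a).elim (hA i (by omega)) fun h => hB i h hi
    exact hrep i₁ j₁ h₁ (by omega) hc₁ (hf _ (by omega) (by omega)) (hf _ (by omega) h₁')
  have hBC : full a b → full b n → False := fun hB hC => by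
    have hf : full a n := fun i hi' hi => (lt_or_ge i b).elim (hB i hi') fun h => hC i h hi
    exact hrep i₂ j₂ h₂' h₂'' hc₂ (hf _ h₂ (by omega)) (hf _ (by omega) h₂'')
  have hAC : full 0 a → full b n → False := fun hA hC =>
    hrep i₃ j₃ h₃ h₃' hc₃ (h₃i.elim (hA i₃ (by omega)) fun h => hC i₃ h (by omega))
      (h₃j.elim (hA j₃ (by omega)) fun h => hC j₃ h h₃')
  rcases h12 with h | h
  · exact h23.elim (hAB h) (hAC h)
  · exact h13.elim (fun h' => hAB h' h) (hBC h)

theorem cycleGraph_exists_walk_forward (hn : 3 ≤ n) (d : ℕ) :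
    ∀ x y : Fin n, (x : ℕ) + d = y → ∃ p : (cycleGraph n).Walk x y, p.length = d := by
  induction d with
  | zero =>
    intro x y h
    obtain rfl : x = y := Fin.ext h
    exact ⟨.nil, rfl⟩
  | succ d ih =>
    intro x y h
    obtain ⟨p, hp⟩ := ih ⟨x + 1, by omega⟩ y (by simp only; omega)
    exact ⟨.cons ((cycleGraph_adj_iff_val hn _ _).2 (Or.inl rfl)) p, by simp [hp]⟩

theorem cycleGraph_exists_walk_wrap (hn : 3 ≤ n) (x y : Fin n) :
    ∃ p : (cycleGraph n).Walk y x, p.length = n - y + x := by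
  obtain ⟨p, hp⟩ := cycleGraph_exists_walk_forward hn (n - 1 - y) y ⟨n - 1, by omega⟩
    (by simp only; omega)
  obtain ⟨q, hq⟩ := cycleGraph_exists_walk_forward hn x ⟨0, by omega⟩ x (by simp)
  refine ⟨p.append (.cons ((cycleGraph_adj_iff_val hn _ _).2
    (Or.inr (Or.inr (Or.inr ⟨rfl, by simp only; omega⟩)))) q), ?_⟩
  rw [Walk.length_append, Walk.length_cons, hp, hq]
  omega

/-- Three vertices cut the cycle into arcs of total length `n`; omitting a longest one leaves at
most two thirds. -/
theorem steinerDiam_le_of_iso_cycleGraph [Finite W] (hn : 3 ≤ n) (e : cycleGraph n ≃g G) :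
    3 * steinerDiam 3 G ≤ 2 * n := by
  suffices h : steinerDiam 3 G ≤ 2 * n / 3 by omega
  refine steinerDiam_le fun S hS => ?_
  have hS' : (S.map e.symm.toEquiv.toEmbedding).card = 3 := by rw [Finset.card_map, hS]
  let f := (S.map e.symm.toEquiv.toEmbedding).orderEmbOfFin hS'
  have hmem : ∀ w ∈ S, w = e (f 0) ∨ w = e (f 1) ∨ w = e (f 2) := by
    intro w hw
    have h1 : e.symm w ∈ Set.range f := by
      rw [Finset.range_orderEmbOfFin]
      exact Finset.mem_coe.2 (Finset.mem_map_of_mem _ hw)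
    obtain ⟨i, hi⟩ := h1
    have hw' : w = e (f i) := by rw [hi]; simp
    fin_cases i
    · exact Or.inl hw'
    · exact Or.inr (Or.inl hw')
    · exact Or.inr (Or.inr hw')
  have h01 : f 0 < f 1 := f.strictMono (by decide)
  have h12 : f 1 < f 2 := f.strictMono (by decide)
  rw [Fin.lt_def] at h01 h12
  obtain ⟨p, hp⟩ := cycleGraph_exists_walk_forward hn (f 1 - f 0) (f 0) (f 1) (by omega)
  obtain ⟨q, hq⟩ := cycleGraph_exists_walk_forward hn (f 2 - f 1) (f 1) (f 2) (by omega)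
  obtain ⟨r, hr⟩ := cycleGraph_exists_walk_wrap hn (f 0) (f 2)
  have h1 := steinerDist_le_of_walks (p.map e.toHom) (q.map e.toHom) hmem
  have h2 := steinerDist_le_of_walks (q.map e.toHom) (r.map e.toHom) (S := S)
    fun w hw => by have := hmem w hw; tauto
  have h3 := steinerDist_le_of_walks (r.map e.toHom) (p.map e.toHom) (S := S)
    fun w hw => by have := hmem w hw; tauto
  rw [Walk.length_map, Walk.length_map] at h1 h2 h3
  omega

end Cycle

/-! ### Containments among the excluded graphs. -/

theorem pathGraph_isIndContained_pathGraph {k m : ℕ} (h : k ≤ m) :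
    (pathGraph k).IsIndContained (pathGraph m) :=
  ⟨⟨⟨Fin.castLE h, Fin.castLE_injective h⟩, by simp [pathGraph_adj]⟩⟩

theorem pathGraph_three_isIndContained_starK : (pathGraph 3).IsIndContained (starK 3) := by
  refine ⟨⟨⟨![.inr 0, .inl 0, .inr 1], by decide⟩, fun {i j} => ?_⟩⟩
  rw [pathGraph_adj]
  fin_cases i <;> fin_cases j <;> simp

theorem pathGraph_four_isIndContained_hairyComplete :
    (pathGraph 4).IsIndContained (hairyComplete 3) := by
  refine ⟨⟨⟨![.inr 0, .inl 0, .inl 1, .inr 1], by decide⟩, fun {i j} => ?_⟩⟩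
  rw [pathGraph_adj]
  fin_cases i <;> fin_cases j <;> simp [hairyComplete]

theorem nonempty_starK_two_iso_pathGraph : Nonempty (starK 2 ≃g pathGraph 3) := by
  have h := nonempty_iso_pathGraph_of_numbering (H := starK 2)
    (connected_of_exists_walk starK_exists_walk)
    (f := Sum.elim (fun _ => 1) fun i => 2 * (i : ℕ)) (by decide) (by
      rintro (a | a) (b | b) <;> fin_cases a <;> fin_cases b <;> simp)
  rwa [show Nat.card (Fin 1 ⊕ Fin 2) = 3 by simp] at h

theorem FamilyContains.not_isIndContained {ι : Type*} {V : ι → Type*} {W W' : Type*}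
    {F : ∀ i, SimpleGraph (V i)} {H : SimpleGraph W'} {G : SimpleGraph W}
    (hH : FamilyContains F H) (hG : IsFamilyFree F G) : ¬ H.IsIndContained G := by
  obtain ⟨i, ⟨e⟩⟩ := hH
  exact fun h => hG i (e.isIndContained.trans h)

end SimpleGraph

/-! ### The characterization. -/

theorem theorem10 {ι : Type*} [Finite ι] (V : ι → Type*) [∀ i, Finite (V i)]
    (F : ∀ i, SimpleGraph (V i)) (hconn : ∀ i, (F i).Connected)
    (hcard : ∀ i, 3 ≤ Nat.card (V i)) :
    (∃ C : ℕ, ∀ (W : Type*) [Finite W] (G : SimpleGraph W), G.Connected → 3 ≤ Nat.card W →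
        SimpleGraph.IsFamilyFree F G →
        SimpleGraph.rainbowIndex 3 G ≤ SimpleGraph.steinerDiam 3 G + C) ↔
      (SimpleGraph.ContainsFirst F ∨ SimpleGraph.ContainsSecond F ∨
        SimpleGraph.ContainsThird F) := by
  constructor
  · rintro ⟨C, hC⟩
    -- A graph violating the bound cannot be F-free; `ULift` moves the model into the universe of
    -- the hypothesis.
    have model : ∀ {U : Type} [Finite U] (H : SimpleGraph U), H.Connected → 3 ≤ Nat.card U →
        (∀ {W : Type _} [Finite W] {G : SimpleGraph W}, H ≃g G → G.Connected → 3 ≤ Nat.card W →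
          SimpleGraph.steinerDiam 3 G + C < SimpleGraph.rainbowIndex 3 G) →
        ∃ i, (F i).IsIndContained H := by
      intro U _ H hH hU hlt
      let e : H ≃g H.comap (Equiv.ulift : ULift U ≃ U) := (SimpleGraph.Iso.comap _ H).symm
      have hconn' := e.connected_iff.1 hH
      have hcard' : 3 ≤ Nat.card (ULift U) := by rwa [Nat.card_congr Equiv.ulift]
      by_contra! hfree
      exact absurd (hC _ _ hconn' hcard' fun i h => hfree i (h.trans e.isIndContained'))
        (not_le.2 (hlt e hconn' hcard'))
    -- Here sdiam_3 is at most 4; for K_s^h below it is at most 6, hence `C + 7`.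
    obtain ⟨i₁, h₁⟩ := model (SimpleGraph.starK (C + 5))
      (SimpleGraph.connected_of_exists_walk SimpleGraph.starK_exists_walk) (by simp; omega) (by
        intro W _ G e hG hW
        have h1 := e.le_rainbowIndex_of_pendant hG hW (u := Sum.inr) (w := fun _ => Sum.inl 0)
          Sum.inr_injective (by simp) SimpleGraph.starK_adj_inr
        have h2 := SimpleGraph.steinerDiam_three_le_of_walks
          (e.exists_walk_length_le SimpleGraph.starK_exists_walk)
        omega)
    obtain ⟨i₂, h₂⟩ := model (SimpleGraph.hairyComplete (C + 7))
      (SimpleGraph.connected_of_exists_walk SimpleGraph.hairyComplete_exists_walk)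
      (by simp; omega) (by
        intro W _ G e hG hW
        have h1 := e.le_rainbowIndex_of_pendant hG hW (u := Sum.inr) (w := Sum.inl)
          Sum.inr_injective (by simp) SimpleGraph.hairyComplete_adj_inr
        have h2 := SimpleGraph.steinerDiam_three_le_of_walks
          (e.exists_walk_length_le SimpleGraph.hairyComplete_exists_walk)
        omega)
    obtain ⟨M, hM⟩ := Set.finite_range (fun i => Nat.card (V i)) |>.bddAbove
    have hM' : ∀ i, Nat.card (V i) ≤ M := fun i => hM ⟨i, rfl⟩
    -- n - 2 > 2n/3 + C needs n > 3C + 6; adding `M` makes the cycle longer than every member of F.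
    obtain ⟨i₃, h₃⟩ := model (SimpleGraph.cycleGraph (3 * C + M + 7 + 1))
      SimpleGraph.cycleGraph_connected (by simp) (by
        intro W _ G e hG hW
        have h1 := SimpleGraph.le_rainbowIndex_of_iso_cycleGraph (by omega) e hG
        have h2 := SimpleGraph.steinerDiam_le_of_iso_cycleGraph (by omega) e
        omega)
    have hc₁ := hcard i₁
    have hc₃ := hcard i₃
    have hstar := SimpleGraph.nonempty_iso_starK_of_isIndContained (hconn i₁) (by omega) h₁
    have hpath := SimpleGraph.nonempty_iso_pathGraph_of_isIndContained_cycleGraph (hconn i₃)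
      (by omega) (by have := hM' i₃; omega) h₃
    -- A star with two leaves is P_3; otherwise the order of the path selects the case.
    rcases hc₁.eq_or_lt with heq | hlt
    · rw [← heq] at hstar
      obtain ⟨e⟩ := hstar
      obtain ⟨e'⟩ := SimpleGraph.nonempty_starK_two_iso_pathGraph
      exact Or.inl ⟨i₁, ⟨e.trans e'⟩⟩
    · have hr : 3 ≤ Nat.card (V i₁) - 1 := by omega
      rcases lt_trichotomy (Nat.card (V i₃)) 4 with hl | hl | hl
      · rw [show Nat.card (V i₃) = 3 by omega] at hpath
        exact Or.inl ⟨i₃, hpath⟩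
      · rw [hl] at hpath
        exact Or.inr (Or.inl ⟨_, hr, ⟨i₁, hstar⟩, ⟨i₃, hpath⟩⟩)
      · exact Or.inr (Or.inr ⟨_, _, _, hr, by omega, hl, ⟨i₁, hstar⟩, ⟨i₂, h₂⟩, ⟨i₃, hpath⟩⟩)
  · intro h
    -- All cases reduce to three excluded graphs: P_3 lies in K_{1,3}, and P_3 and P_4 lie in K_3^h.
    obtain ⟨r, s, l, hrsl⟩ : ∃ r s l : ℕ, ∀ {W : Type _} (G : SimpleGraph W),
        SimpleGraph.IsFamilyFree F G → ¬ (SimpleGraph.starK r).IsIndContained G ∧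
          ¬ (SimpleGraph.hairyComplete s).IsIndContained G ∧
          ¬ (SimpleGraph.pathGraph l).IsIndContained G := by
      have h34 := SimpleGraph.pathGraph_isIndContained_pathGraph (show 3 ≤ 4 by norm_num)
      have h4 := SimpleGraph.pathGraph_four_isIndContained_hairyComplete
      rcases h with h | ⟨r, -, hr, h⟩ | ⟨r, s, l, -, -, -, hr, ⟨i, hi⟩, hl⟩
      · refine ⟨3, 3, 3, fun G hG => ?_⟩
        have h3 := h.not_isIndContained hG
        exact ⟨fun h' => h3 (SimpleGraph.pathGraph_three_isIndContained_starK.trans h'),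
          fun h' => h3 ((h34.trans h4).trans h'), h3⟩
      · exact ⟨r, 3, 4, fun G hG => ⟨hr.not_isIndContained hG,
          fun h' => h.not_isIndContained hG (h4.trans h'), h.not_isIndContained hG⟩⟩
      · exact ⟨r, s, l, fun G hG => ⟨hr.not_isIndContained hG, fun h' => hG i (hi.trans h'),
          hl.not_isIndContained hG⟩⟩
    obtain ⟨C, hC⟩ := SimpleGraph.exists_bound_rainbowIndex r s l
    refine ⟨C, fun W _ G hG _ hfree => ?_⟩
    obtain ⟨hr, hs, hl⟩ := hrsl G hfree
    exact (hC W G hG hr hs hl).trans (Nat.le_add_left _ _)
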